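/- **Theorem 4 (No-free-lunch: time-series version).** Let $\Xi_0$ be the set of laws $P=P_{(\mathbf X,\mathbf Y,\mathbf Z)}$ of strictly stationary real trivariate time series $\mathbf W=(\mathbf W_t)_{t\in\mathbb Z}=(X_t,Y_t,Z_t)_{t\in\mathbb Z}$ such that 1. (continuity) for every $m$, the vector $(\mathbf W_1,\dots,\mathbf W_m)$ has a density with respect to Lebesgue measure on $\mathbb R^{3m}$; 2. (structural generation without hidden confounders) for some measurable functions $h_X,h_Y:\mathbb R^4\to\mathbb R$ and some real noise variables $\varepsilon^X_t,\varepsilon^Y_t$, almost surely for every $t\in\mathbb Z$, $$X_t=h_X(X_{t-1},Y_{t-1},Z_{t-1},\varepsilon^X_t),\qquad Y_t=h_Y(X_{t-1},Y_{t-1},Z_{t-1},\varepsilon^Y_t),$$ where, for every $t$, the pair $(\varepsilon^X_t,\varepsilon^Y_t)$ is independent of the past $(\mathbf W_s)_{s<t}$ (the two components of the pair may be dependent, and no equation is imposed on $\mathbf Z$). Say that $\mathbf X$ does not Granger-cause $\mathbf Y$ if, for every $t$, $Y_{t+1}$ is conditionally independent of $(X_s)_{s\le t}$ given $(Y_s,Z_s)_{s\le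 t}$. Let $\mathcal P_0$ be the set of $P\in\Xi_0$ under which the null hypothesis $H_0$: "$\mathbf X$ does not Granger-cause $\mathbf Y$" holds, and let $\mathcal Q_0=\Xi_0\setminus\mathcal P_0$. Let $n\in\mathbb N$ be any sample size, $\alpha\in(0,1)$ any significance level, and let $\psi_n:(\mathbb R^3)^n\to\{0,1\}$ be any measurable test, which rejects $H_0$ when $\psi_n(\mathbf W_1,\dots,\mathbf W_n)=1$. If $$\sup_{P\in\mathcal P_0}P(\psi_n=1)\le\alpha ,$$ then $Q(\psi_n=1)\le\alpha$ for every $Q\in\mathcal Q_0$. Thus $\psi_n$ cannot have power against any alternative. -/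

import Mathlib

open MeasureTheory ProbabilityTheory

/-- One observation `(x, y, z)` of the three univariate series `X`, `Y`, `Z`. -/
abbrev Obs : Type := ℝ × ℝ × ℝ

/-- A path of the trivariate series `W = (X, Y, Z)`, indexed by the integers. -/
abbrev SeriesPath : Type := ℤ → Obs

/-- The sigma-algebra generated by the series `f (W_s)`, `s ≤ t`, on the path space. -/
abbrev pastSigma {β : Type*} [MeasurableSpace β] (f : Obs → β) (t : ℤ) :
    MeasurableSpace SeriesPath :=
  ⨆ s ∈ Set.Iic t, MeasurableSpace.comap (fun w : SeriesPath => f (w s)) inferInstance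

/-- `σ(X_s : s ≤ t)`. -/
abbrev pastX (t : ℤ) : MeasurableSpace SeriesPath := pastSigma (fun o : Obs => o.1) t

/-- `σ(Y_s, Z_s : s ≤ t)`. -/
abbrev pastYZ (t : ℤ) : MeasurableSpace SeriesPath := pastSigma (fun o : Obs => o.2) t

/-- `σ(Y_t)`. -/
abbrev sigmaY (t : ℤ) : MeasurableSpace SeriesPath :=
  MeasurableSpace.comap (fun w : SeriesPath => (w t).2.1) inferInstance

theorem pastYZ_le (t : ℤ) : pastYZ t ≤ (inferInstance : MeasurableSpace SeriesPath) := by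
  refine iSup₂_le fun s _ => ?_
  exact (measurable_snd.comp (measurable_pi_apply s)).comap_le

/-- Under the law `P` of `(X, Y, Z)`, the series `X` Granger-causes `Y` (with respect to `Z`): for
some `t`, `Y_{t+1}` is not conditionally independent of `(X_s)_{s ≤ t}` given
`(Y_s, Z_s)_{s ≤ t}`. -/
def GrangerCauses (P : ProbabilityMeasure SeriesPath) : Prop :=
  ∃ t : ℤ, ¬ CondIndep (pastYZ t) (sigmaY (t + 1)) (pastX t) (pastYZ_le t)
    (P : Measure SeriesPath)

/-- Strict stationarity. -/
def IsStationaryLaw (P : ProbabilityMeasure SeriesPath) : Prop :=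
  (P : Measure SeriesPath).map (fun w t => w (t + 1)) = (P : Measure SeriesPath)

/-- The observed window `(w_1, …, w_n)`. -/
def obsWindow (n : ℕ) (w : SeriesPath) : Fin n → Obs := fun i => w ((i : ℤ) + 1)

/-- The observations `(W_1, …, W_n)` have, for every `n`, a density with respect to Lebesgue
measure. -/
def IsContinuousLaw (P : ProbabilityMeasure SeriesPath) : Prop :=
  ∀ n : ℕ, (P : Measure SeriesPath).map (obsWindow n) ≪ (volume : Measure (Fin n → Obs))

/-- `P` is the law of a series `W = (X, Y, Z)` whose components `X` and `Y` are generated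
structurally, without hidden confounders:
`X_t = h_X(X_{t-1}, Y_{t-1}, Z_{t-1}, ε^X_t)` and `Y_t = h_Y(X_{t-1}, Y_{t-1}, Z_{t-1}, ε^Y_t)`
almost surely for every `t`, with noise `(ε^X_t, ε^Y_t)` independent of the whole past
`(W_s)_{s < t}`. The two components of the noise may be dependent (instantaneous causality), and
no equation is imposed on `Z`. -/
def IsUnconfoundedStructural (P : ProbabilityMeasure SeriesPath) : Prop :=
  ∃ (Ω : Type) (_ : MeasurableSpace Ω) (μ : Measure Ω) (_ : IsProbabilityMeasure μ)
    (W : ℤ → Ω → Obs) (εX εY : ℤ → Ω → ℝ) (hX hY : Obs → ℝ → ℝ),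
    (∀ t, Measurable (W t)) ∧ (∀ t, Measurable (εX t)) ∧ (∀ t, Measurable (εY t)) ∧
    Measurable (Function.uncurry hX) ∧ Measurable (Function.uncurry hY) ∧
    μ.map (fun ω t => W t ω) = (P : Measure SeriesPath) ∧
    (∀ t, ∀ᵐ ω ∂μ, (W t ω).1 = hX (W (t - 1) ω) (εX t ω)) ∧
    (∀ t, ∀ᵐ ω ∂μ, (W t ω).2.1 = hY (W (t - 1) ω) (εY t ω)) ∧
    (∀ t, IndepFun (fun ω (s : Set.Iio t) => W s ω) (fun ω => (εX t ω, εY t ω)) μ)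

/-- The laws of all stationary, unconfounded, structurally generated series `(X, Y, Z)` that are
continuous with respect to Lebesgue measure. -/
def structuralLaws : Set (ProbabilityMeasure SeriesPath) :=
  {P | IsStationaryLaw P ∧ IsContinuousLaw P ∧ IsUnconfoundedStructural P}

/-- The null hypothesis: `X` does not Granger-cause `Y`. -/
def nullLaws : Set (ProbabilityMeasure SeriesPath) :=
  {P | P ∈ structuralLaws ∧ ¬ GrangerCauses P}

/-- The alternative. -/
def alternativeLaws : Set (ProbabilityMeasure SeriesPath) := structuralLaws \ nullLaws

/-- The probability that the test `ψ`, applied to `(W_1, …, W_n)`, rejects (`ψ = 1`) when `W` has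
law `P`. -/
noncomputable def rejectionProb {n : ℕ} (ψ : (Fin n → Obs) → Fin 2)
    (P : ProbabilityMeasure SeriesPath) : ENNReal :=
  (P : Measure SeriesPath) {w | ψ (obsWindow n w) = 1}

/-! ### Uniform noise and the box series -/

open Filter Topology

/-! A stationary continuous law Q can be imitated by null laws, because `Z` can secretly announce
the future. Discretise a path of Q into finitely many cells of a grid of mesh `δ`, and at each time
put a fresh uniform point into the box of the current cell. Cut the third side of that box into `M +
1` subintervals, and confine the third coordinate to the one with index `e (c, c')`, where `c` and
`c'` are the present and next cells. If `e` is injective, `Z_t` determines the cell at time `t + 1`,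
so `X_{t+1}` and `Y_{t+1}` are functions of `Z_t` and fresh noise: the new law is structural, and
the past of `X` adds nothing to that of `(Y, Z)`. It is therefore a null law
(`embedLaw_mem_nullLaws`), rejected with probability at most `α`.

A single code `e` distorts the law inside the boxes, but a uniformly random one does not. When the
cells at times `1, …, n` are distinct, the `n` codes used are independent and uniform, so averaging
over `e` makes the window exactly uniform in its boxes (`lintegral_embedLaw`). A random code fails
to be injective with probability `O(1 / M)`. Letting `M` tend to infinity bounds by `α` the
Q-integral of `boxProb`, the proportion of the box around the window that lies in the rejection
region `R`, over windows with distinct cells (`lintegral_boxProb_le`).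

Finally the mesh tends to zero. Since Q has densities, almost every window has distinct entries,
which distinct cells eventually separate, and `boxProb` tends to 1 at almost every window in `R` by
Lebesgue's density theorem (`ae_tendsto_boxProb`). Fatou's lemma gives `Q(R) ≤ α`. -/

/-- The uniform distribution on the unit interval. -/
noncomputable abbrev unitLaw : Measure ℝ := volume.restrict (Set.Icc 0 1)

/-- The uniform distribution on the unit cube. -/
noncomputable abbrev cubeLaw : Measure Obs := unitLaw.prod (unitLaw.prod unitLaw)

instance : IsProbabilityMeasure unitLaw := ⟨by simp⟩

instance : (volume : Measure Obs).IsAddHaarMeasure :=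
  have : (volume : Measure (ℝ × ℝ)).IsAddHaarMeasure :=
    Measure.prod.instIsAddHaarMeasure volume volume
  Measure.prod.instIsAddHaarMeasure volume volume

instance (n : ℕ) : (volume : Measure (Fin n → Obs)).IsAddHaarMeasure :=
  Measure.pi.isAddHaarMeasure fun _ : Fin n => (volume : Measure Obs)

/-- The law of an independent sequence of uniform points of the unit cube. -/
noncomputable abbrev noiseLaw : Measure (ℤ → Obs) := Measure.infinitePi fun _ => cubeLaw

/-- The coordinatewise affine map that sends the unit cube to the box with corner `p` and sides
`δ`, `δ`, `η`. -/
def boxMap (δ η : ℝ) (p u : Obs) : Obs := (p.1 + δ * u.1, p.2.1 + δ * u.2.1, p.2.2 + η * u.2.2)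

/-- The series obtained from a path and a sequence of points of the unit cube by placing the
observation at time `t` in the box whose corner is determined by the cells of the path at the times
`t` and `t + 1`. -/
def boxSeries {K : Type} (q : Obs → K) (p : K → K → Obs) (δ η : ℝ)
    (a : SeriesPath × (ℤ → Obs)) : SeriesPath :=
  fun t => boxMap δ η (p (q (a.1 t)) (q (a.1 (t + 1)))) (a.2 t)

section BoxSeries

variable {K : Type} [Countable K] [MeasurableSpace K] [MeasurableSingletonClass K]
  {q : Obs → K} (p : K → K → Obs) (δ η : ℝ)

@[fun_prop]
theorem measurable_boxMap : Measurable fun a : Obs × Obs => boxMap δ η a.1 a.2 := by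
  unfold boxMap; fun_prop

theorem measurable_uncurry_of_countable : Measurable (Function.uncurry p) :=
  measurable_of_countable _

theorem measurable_boxSeries_apply (hq : Measurable q) (t : ℤ) :
    Measurable fun a => boxSeries q p δ η a t := by
  have h : Measurable fun a : SeriesPath × (ℤ → Obs) => p (q (a.1 t)) (q (a.1 (t + 1))) :=
    (measurable_uncurry_of_countable p).comp (f := fun a : SeriesPath × (ℤ → Obs) =>
      (q (a.1 t), q (a.1 (t + 1)))) (by fun_prop)
  exact (measurable_boxMap δ η).comp (h.prodMk ((measurable_pi_apply t).comp measurable_snd))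

theorem measurable_boxSeries (hq : Measurable q) : Measurable (boxSeries q p δ η) :=
  measurable_pi_lambda _ fun t => measurable_boxSeries_apply p δ η hq t

/-- The law of `boxSeries` when the path has law `Q` and the noise is independent of it. -/
noncomputable def boxLaw (hq : Measurable q) (Q : ProbabilityMeasure SeriesPath) :
    ProbabilityMeasure SeriesPath :=
  ⟨((Q : Measure SeriesPath).prod noiseLaw).map (boxSeries q p δ η),
    Measure.isProbabilityMeasure_map (measurable_boxSeries p δ η hq).aemeasurable⟩

theorem coe_boxLaw (hq : Measurable q) (Q : ProbabilityMeasure SeriesPath) :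
    (boxLaw p δ η hq Q : Measure SeriesPath) =
      ((Q : Measure SeriesPath).prod noiseLaw).map (boxSeries q p δ η) := rfl

theorem measurable_shift : Measurable fun (w : ℤ → Obs) t => w (t + 1) := by fun_prop

/-- Building the box series commutes with the time shift, which preserves both the path law and the
noise law. -/
theorem isStationaryLaw_boxLaw (hq : Measurable q)
    {Q : ProbabilityMeasure SeriesPath} (hQ : IsStationaryLaw Q) :
    IsStationaryLaw (boxLaw p δ η hq Q) := by
  have hnoise : noiseLaw.map (fun w t => w (t + 1)) = noiseLaw :=
    Measure.map_infinitePi_infinitePi_of_inj (P := fun _ : ℤ => cubeLaw)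
      (add_left_injective (1 : ℤ))
  unfold IsStationaryLaw at *
  rw [coe_boxLaw, Measure.map_map measurable_shift (measurable_boxSeries p δ η hq)]
  have hcomm : (fun (w : SeriesPath) t => w (t + 1)) ∘ boxSeries q p δ η =
      boxSeries q p δ η ∘ Prod.map (fun w t => w (t + 1)) (fun w t => w (t + 1)) := rfl
  rw [hcomm, ← Measure.map_map (measurable_boxSeries p δ η hq)
    (measurable_shift.prodMap measurable_shift), ← Measure.map_prod_map _ _ measurable_shift
    measurable_shift, hQ, hnoise]

theorem measurable_obsWindow (n : ℕ) : Measurable (obsWindow n) := by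
  unfold obsWindow; fun_prop

theorem noiseLaw_map_obsWindow (n : ℕ) :
    noiseLaw.map (obsWindow n) = Measure.pi fun _ : Fin n => cubeLaw := by
  have h : Function.Injective fun i : Fin n => (i : ℤ) + 1 := fun i j hij => by
    simpa [Fin.ext_iff] using hij
  have := Measure.map_infinitePi_infinitePi_of_inj (P := fun _ : ℤ => cubeLaw) h
  rw [← Measure.infinitePi_eq_pi]
  exact this

theorem boxLaw_obsWindow_preimage (hq : Measurable q) (Q : ProbabilityMeasure SeriesPath) {n : ℕ}
    {R : Set (Fin n → Obs)} (hR : MeasurableSet R) :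
    (boxLaw p δ η hq Q : Measure SeriesPath) (obsWindow n ⁻¹' R) =
      ∫⁻ w, Measure.pi (fun _ : Fin n => cubeLaw)
        {u | (fun i => boxMap δ η
          (p (q (obsWindow n w i)) (q (w ((i : ℤ) + 1 + 1)))) (u i)) ∈ R} ∂Q := by
  have hm := measurable_boxSeries p δ η hq
  have hs : MeasurableSet (obsWindow n ⁻¹' R) := measurable_obsWindow n hR
  rw [coe_boxLaw, Measure.map_apply hm hs, Measure.prod_apply (hm hs)]
  refine lintegral_congr fun w => ?_
  rw [← noiseLaw_map_obsWindow, Measure.map_apply (measurable_obsWindow n)]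
  · rfl
  · refine hR.preimage (measurable_pi_lambda _ fun i => ?_)
    exact (measurable_boxMap δ η).comp (measurable_const.prodMk (measurable_pi_apply i))

theorem pi_cubeLaw_absolutelyContinuous (n : ℕ) :
    Measure.pi (fun _ : Fin n => cubeLaw) ≪ volume := by
  rw [cubeLaw, Measure.prod_restrict, Measure.prod_restrict, ← Measure.restrict_pi_pi]
  exact Measure.restrict_le_self.absolutelyContinuous

/-- Placement in boxes has the affine inverse `G`, and differentiable maps send Lebesgue-null sets
to null sets. -/
theorem pi_cubeLaw_boxMap_preimage_null {δ η : ℝ} (hδ : δ ≠ 0) (hη : η ≠ 0) {n : ℕ}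
    (c : Fin n → Obs) {N : Set (Fin n → Obs)} (hN : volume N = 0) :
    Measure.pi (fun _ : Fin n => cubeLaw) {u | (fun i => boxMap δ η (c i) (u i)) ∈ N} = 0 := by
  apply pi_cubeLaw_absolutelyContinuous n
  let G : (Fin n → Obs) → Fin n → Obs := fun v i =>
    (δ⁻¹ * ((v i).1 - (c i).1), δ⁻¹ * ((v i).2.1 - (c i).2.1), η⁻¹ * ((v i).2.2 - (c i).2.2))
  refine measure_mono_null (t := G '' N) (fun u hu => ⟨_, hu, ?_⟩) ?_
  · ext i <;> simp [G, boxMap, hδ, hη]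
  · refine addHaar_image_eq_zero_of_differentiableOn_of_addHaar_eq_zero volume ?_ hN
    refine Differentiable.differentiableOn ?_
    simp only [G]
    fun_prop

theorem isContinuousLaw_boxLaw (hq : Measurable q) (hδ : δ ≠ 0) (hη : η ≠ 0)
    (Q : ProbabilityMeasure SeriesPath) :
    IsContinuousLaw (boxLaw p δ η hq Q) := by
  intro n
  refine Measure.AbsolutelyContinuous.mk fun N hN hN0 => ?_
  rw [Measure.map_apply (measurable_obsWindow n) hN, boxLaw_obsWindow_preimage p δ η hq Q hN]
  simp [pi_cubeLaw_boxMap_preimage_null hδ hη _ hN0]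

theorem indepFun_noiseLaw (t : ℤ) :
    IndepFun (fun (u : ℤ → Obs) (s : Set.Iio t) => u s) (fun u => u t) noiseLaw := by
  have h : iIndepFun (fun (s : ℤ) (u : ℤ → Obs) => u s) noiseLaw :=
    iIndepFun_infinitePi (P := fun _ : ℤ => cubeLaw) (X := fun _ x => x) fun _ => measurable_id
  have h2 := indep_iSup_of_disjoint (fun s => (measurable_pi_apply s).comap_le) h
    (S := Set.Iio t) (T := {t}) (by simp)
  rw [IndepFun_iff_Indep]
  refine indep_of_indep_of_le_left (indep_of_indep_of_le_right h2 ?_) ?_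
  · exact le_iSup₂_of_le t rfl le_rfl
  · rw [← measurable_iff_comap_le]
    refine @measurable_pi_lambda _ _ _ (_) _ _ fun s => ?_
    rw [measurable_iff_comap_le]
    exact le_iSup₂_of_le (f := fun s (_ : s ∈ Set.Iio t) =>
      MeasurableSpace.comap (fun u : ℤ → Obs => u s) inferInstance) s.1 s.2 le_rfl

theorem indepFun_prod_noiseLaw (Q : ProbabilityMeasure SeriesPath) (t : ℤ) :
    IndepFun (fun (a : SeriesPath × (ℤ → Obs)) => (a.1, fun (s : Set.Iio t) => a.2 s))
      (fun a => a.2 t) ((Q : Measure SeriesPath).prod noiseLaw) := by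
  have m1 : Measurable fun (u : ℤ → Obs) (s : Set.Iio t) => u s := by fun_prop
  have m2 : Measurable fun (u : ℤ → Obs) => u t := by fun_prop
  have h := (indepFun_iff_map_prod_eq_prod_map_map m1.aemeasurable m2.aemeasurable).1
    (indepFun_noiseLaw t)
  rw [indepFun_iff_map_prod_eq_prod_map_map (by fun_prop) (by fun_prop)]
  have e1 : ((Q : Measure SeriesPath).prod noiseLaw).map
      (fun a => (a.1, fun (s : Set.Iio t) => a.2 s)) =
      (Q : Measure SeriesPath).prod (noiseLaw.map fun u (s : Set.Iio t) => u s) := by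
    have := Measure.map_prod_map (Q : Measure SeriesPath) noiseLaw measurable_id m1
    rw [Measure.map_id] at this
    exact this.symm
  have e2 : ((Q : Measure SeriesPath).prod noiseLaw).map (fun a => a.2 t) =
      noiseLaw.map fun u => u t := by
    rw [show (fun a : SeriesPath × (ℤ → Obs) => a.2 t) = (fun u => u t) ∘ Prod.snd from rfl,
      ← Measure.map_map m2 measurable_snd, Measure.map_snd_prod]
    simp
  have e3 := Measure.map_prod_map (Q : Measure SeriesPath) noiseLaw measurable_id (m1.prodMk m2)
  rw [Measure.map_id, h] at e3
  have i1 := Measure.isProbabilityMeasure_map (μ := noiseLaw) m1.aemeasurable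
  have i2 := Measure.isProbabilityMeasure_map (μ := noiseLaw) m2.aemeasurable
  rw [e1, e2]
  have := (measurePreserving_prodAssoc (Q : Measure SeriesPath)
    (noiseLaw.map fun u (s : Set.Iio t) => u s) (noiseLaw.map fun u => u t)).symm.map_eq
  rw [← this, e3, Measure.map_map (MeasurableEquiv.measurable _) (by fun_prop)]
  rfl

/-- The series before `t` looks ahead to the cell at time `t`. This is harmless: the noise at `t` is
independent of the entire path, future included. -/
theorem indepFun_boxSeries (hq : Measurable q) (Q : ProbabilityMeasure SeriesPath) (t : ℤ) :
    IndepFun (fun a (s : Set.Iio t) => boxSeries q p δ η a s) (fun a => a.2 t)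
      ((Q : Measure SeriesPath).prod noiseLaw) := by
  have hm : Measurable fun (b : SeriesPath × (Set.Iio t → Obs)) (s : Set.Iio t) =>
      boxMap δ η (p (q (b.1 s)) (q (b.1 ((s : ℤ) + 1)))) (b.2 s) := by
    refine measurable_pi_lambda _ fun s => ?_
    have h : Measurable fun b : SeriesPath × (Set.Iio t → Obs) =>
        p (q (b.1 s)) (q (b.1 ((s : ℤ) + 1))) :=
      (measurable_uncurry_of_countable p).comp (f := fun b : SeriesPath × (Set.Iio t → Obs) =>
        (q (b.1 s), q (b.1 ((s : ℤ) + 1)))) (by fun_prop)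
    exact (measurable_boxMap δ η).comp (h.prodMk ((measurable_pi_apply s).comp measurable_snd))
  exact (indepFun_prod_noiseLaw Q t).comp hm measurable_id

theorem ae_noise_mem_Ico (Q : ProbabilityMeasure SeriesPath) (t : ℤ) :
    ∀ᵐ a ∂(Q : Measure SeriesPath).prod noiseLaw, (a.2 t).2.2 ∈ Set.Ico (0 : ℝ) 1 := by
  have h1 : ∀ᵐ x ∂unitLaw, x ∈ Set.Ico (0 : ℝ) 1 := by
    rw [unitLaw, ← restrict_Ico_eq_restrict_Icc]
    exact ae_restrict_mem measurableSet_Ico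
  have h2 : Measure.QuasiMeasurePreserving (fun a : SeriesPath × (ℤ → Obs) => (a.2 t).2.2)
      ((Q : Measure SeriesPath).prod noiseLaw) unitLaw :=
    Measure.quasiMeasurePreserving_snd.comp <| Measure.quasiMeasurePreserving_snd.comp <|
      (measurePreserving_eval_infinitePi (fun _ : ℤ => cubeLaw) t).quasiMeasurePreserving.comp
        Measure.quasiMeasurePreserving_snd
  exact h2.ae h1

end BoxSeries

/-! ### Structural equations from a decodable third coordinate -/

section BoxSeries

variable {K : Type} [Countable K] [MeasurableSpace K] [MeasurableSingletonClass K]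
  {q : Obs → K} {x y : K → ℝ} {z : K → K → ℝ} {δ η : ℝ} {dec : ℝ → K}

theorem isUnconfoundedStructural_boxLaw (hq : Measurable q) (hdec : Measurable dec)
    (hz : ∀ c c', ∀ u ∈ Set.Ico (0 : ℝ) 1, dec (z c c' + η * u) = c')
    (Q : ProbabilityMeasure SeriesPath) :
    IsUnconfoundedStructural (boxLaw (fun c c' => (x c, y c, z c c')) δ η hq Q) := by
  have hdecode (t : ℤ) : ∀ᵐ a ∂(Q : Measure SeriesPath).prod noiseLaw,
      dec (boxSeries q (fun c c' => (x c, y c, z c c')) δ η a (t - 1)).2.2 = q (a.1 t) := by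
    filter_upwards [ae_noise_mem_Ico Q (t - 1)] with a ha
    have h := hz (q (a.1 (t - 1))) (q (a.1 (t - 1 + 1))) _ ha
    rwa [← congrArg (fun s => q (a.1 s)) (sub_add_cancel t 1)]
  refine ⟨SeriesPath × (ℤ → Obs), inferInstance, (Q : Measure SeriesPath).prod noiseLaw,
    inferInstance, fun t a => boxSeries q (fun c c' => (x c, y c, z c c')) δ η a t,
    fun t a => (a.2 t).1, fun t a => (a.2 t).2.1, fun o e => x (dec o.2.2) + δ * e,
    fun o e => y (dec o.2.2) + δ * e, measurable_boxSeries_apply _ δ η hq, by fun_prop,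
    by fun_prop, ?_, ?_, rfl, fun t => ?_, fun t => ?_, fun t => ?_⟩
  · exact ((measurable_of_countable x).comp (hdec.comp (by fun_prop :
      Measurable fun a : Obs × ℝ => a.1.2.2))).add (by fun_prop)
  · exact ((measurable_of_countable y).comp (hdec.comp (by fun_prop :
      Measurable fun a : Obs × ℝ => a.1.2.2))).add (by fun_prop)
  · filter_upwards [hdecode t] with a ha
    rw [ha]; rfl
  · filter_upwards [hdecode t] with a ha
    rw [ha]; rfl
  · exact (indepFun_boxSeries (fun c c' => (x c, y c, z c c')) δ η hq Q t).comp measurable_id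
      (by fun_prop : Measurable fun o : Obs => (o.1, o.2.1))

end BoxSeries

/-! ### Conditional independence and absence of Granger causality -/

/-- Given `m ⊔ m₂`, the variable `V` is known and `E` is still pure noise, so the conditional
probability of an event of `g (V, E)` depends on `V` alone and is already `m`-measurable. The tower
property then yields the product formula. -/
theorem condIndep_of_indep_noise {Ω β K : Type*} {m m₂ mΩ : MeasurableSpace Ω}
    [StandardBorelSpace Ω] [MeasurableSpace β] [Fintype K] [MeasurableSpace K]
    [MeasurableSingletonClass K] {μ : Measure Ω} [IsProbabilityMeasure μ] (hm : m ≤ mΩ)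
    (hm₂ : m₂ ≤ mΩ) {V : Ω → K} (hV : Measurable[m] V) {E : Ω → ℝ} (hE : Measurable E)
    (hindep : Indep (m ⊔ m₂) (MeasurableSpace.comap E inferInstance) μ) {g : K → ℝ → β}
    (hg : ∀ c, Measurable (g c)) :
    CondIndep m (MeasurableSpace.comap (fun ω => g (V ω) (E ω)) inferInstance) m₂ hm μ := by
  classical
  have hsup : m ⊔ m₂ ≤ mΩ := sup_le hm hm₂
  have hmeas : Measurable fun ω => g (V ω) (E ω) :=
    (measurable_from_prod_countable_right (f := fun a : K × ℝ => g a.1 a.2) hg).comp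
      ((hV.mono hm le_rfl).prodMk hE)
  rw [condIndep_iff _ _ _ _ hmeas.comap_le hm₂]
  rintro _ t₂ ⟨B, hB, rfl⟩ ht₂
  set t₁ := (fun ω => g (V ω) (E ω)) ⁻¹' B with ht₁def
  have ht₁ : MeasurableSet t₁ := hmeas hB
  let ind : Set Ω → Ω → ℝ := fun s => s.indicator fun _ => 1
  have hint {s : Set Ω} (hs : MeasurableSet s) : Integrable (ind s) μ :=
    (integrable_const 1).indicator hs
  -- The conditional probability of `t₁` with `V` frozen at its value `c`.
  let ψ : Ω → ℝ := fun ω => ∑ c, ind (V ⁻¹' {c}) ω * μ.real (E ⁻¹' (g c ⁻¹' B))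
  have hVc (c : K) : MeasurableSet[m] (V ⁻¹' {c}) := hV (measurableSet_singleton c)
  have hψ : StronglyMeasurable[m] ψ := by
    refine Finset.stronglyMeasurable_fun_sum _ fun c _ => ?_
    exact (stronglyMeasurable_const.indicator (hVc c)).mul_const _
  have hdecomp : ind t₁ = ∑ c, ind (V ⁻¹' {c}) * ind (E ⁻¹' (g c ⁻¹' B)) := by
    funext ω
    rw [Finset.sum_apply, Finset.sum_eq_single (V ω)]
    · simp [ind, t₁, Set.indicator_apply]
    · intro c _ hc
      simp [ind, Set.indicator_apply, hc.symm]
    · simp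
  have hprod (c : K) : Integrable (ind (V ⁻¹' {c}) * ind (E ⁻¹' (g c ⁻¹' B))) μ := by
    have : ind (V ⁻¹' {c}) * ind (E ⁻¹' (g c ⁻¹' B)) = ind (V ⁻¹' {c} ∩ E ⁻¹' (g c ⁻¹' B)) := by
      funext ω
      simp only [ind, Pi.mul_apply, Set.indicator_apply, Set.mem_inter_iff]
      split_ifs <;> simp_all
    rw [this]
    exact hint ((hm _ (hVc c)).inter (hE (hg c hB)))
  have hcond : μ[ind t₁ | m ⊔ m₂] =ᵐ[μ] ψ := by
    rw [hdecomp]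
    refine (condExp_finsetSum (fun c _ => hprod c) _).trans ?_
    have hc (c : K) : μ[ind (V ⁻¹' {c}) * ind (E ⁻¹' (g c ⁻¹' B)) | m ⊔ m₂] =ᵐ[μ]
        fun ω => ind (V ⁻¹' {c}) ω * μ.real (E ⁻¹' (g c ⁻¹' B)) := by
      have h1 := condExp_mul_of_stronglyMeasurable_left (m := m ⊔ m₂) (μ := μ)
        (f := ind (V ⁻¹' {c})) (g := ind (E ⁻¹' (g c ⁻¹' B)))
        (stronglyMeasurable_const.indicator (le_sup_left (a := m) (b := m₂) _ (hVc c)))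
        (hprod c) (hint (hE (hg c hB)))
      have h2 : μ[ind (E ⁻¹' (g c ⁻¹' B)) | m ⊔ m₂] =ᵐ[μ]
          fun _ => μ[ind (E ⁻¹' (g c ⁻¹' B))] :=
        condExp_indep_eq hE.comap_le hsup
          (stronglyMeasurable_const.indicator ⟨_, hg c hB, rfl⟩) hindep.symm
      filter_upwards [h1, h2] with ω h1 h2
      rw [h1, Pi.mul_apply, h2]
      simp only [ind]
      rw [integral_indicator_const _ (hE (hg c hB))]
      simp
    filter_upwards [ae_all_iff.2 hc] with ω hω
    rw [Finset.sum_apply]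
    exact Finset.sum_congr rfl fun c _ => hω c
  have hψint : Integrable ψ μ := integrable_condExp.congr hcond
  have hm1 : μ[ind t₁ | m] =ᵐ[μ] ψ := by
    have h := condExp_condExp_of_le (f := ind t₁) (μ := μ) (le_sup_left (a := m) (b := m₂)) hsup
    refine h.symm.trans ((condExp_congr_ae hcond).trans ?_)
    rw [condExp_of_stronglyMeasurable hm hψ hψint]
  have hinter : ind (t₁ ∩ t₂) = ind t₁ * ind t₂ := by
    funext ω
    simp only [ind, Pi.mul_apply, Set.indicator_apply, Set.mem_inter_iff]
    split_ifs <;> simp_all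
  have hind12 : Integrable (ind t₁ * ind t₂) μ := hinter ▸ hint (ht₁.inter (hm₂ _ ht₂))
  have hsupcond : μ[ind (t₁ ∩ t₂) | m ⊔ m₂] =ᵐ[μ] ψ * ind t₂ := by
    rw [hinter]
    refine (condExp_mul_of_stronglyMeasurable_right
      (stronglyMeasurable_const.indicator (le_sup_right (a := m) (b := m₂) _ ht₂)) hind12
      (hint ht₁)).trans ?_
    exact hcond.mul Filter.EventuallyEq.rfl
  have hψ2 : Integrable (ψ * ind t₂) μ := integrable_condExp.congr hsupcond
  calc μ[ind (t₁ ∩ t₂) | m] =ᵐ[μ] μ[μ[ind (t₁ ∩ t₂) | m ⊔ m₂] | m] :=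
        (condExp_condExp_of_le le_sup_left hsup).symm
    _ =ᵐ[μ] μ[ψ * ind t₂ | m] := condExp_congr_ae hsupcond
    _ =ᵐ[μ] ψ * μ[ind t₂ | m] :=
        condExp_mul_of_stronglyMeasurable_left hψ hψ2 (hint (hm₂ _ ht₂))
    _ =ᵐ[μ] μ[ind t₁ | m] * μ[ind t₂ | m] := hm1.symm.mul Filter.EventuallyEq.rfl

theorem pastSigma_le_comap {β : Type*} [MeasurableSpace β] {f : Obs → β} (hf : Measurable f)
    (t : ℤ) : pastSigma f t ≤
      MeasurableSpace.comap (fun (w : SeriesPath) (s : Set.Iio (t + 1)) => w s) inferInstance := by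
  refine iSup₂_le fun s hs => ?_
  have : (fun w : SeriesPath => f (w s)) = (fun v : Set.Iio (t + 1) → Obs =>
      f (v ⟨s, Int.lt_add_one_of_le hs⟩)) ∘ fun (w : SeriesPath) (s : Set.Iio (t + 1)) => w s := rfl
  rw [this, ← MeasurableSpace.comap_comp]
  exact MeasurableSpace.comap_mono (hf.comp (measurable_pi_apply _)).comap_le

section BoxSeries

variable {K : Type} [Fintype K] [MeasurableSpace K] [MeasurableSingletonClass K]
  {q : Obs → K} {x y : K → ℝ} {z : K → K → ℝ} {δ η : ℝ} {dec : ℝ → K}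

theorem not_grangerCauses_boxLaw (hq : Measurable q) (hdec : Measurable dec)
    (hz : ∀ c c', ∀ u ∈ Set.Ico (0 : ℝ) 1, dec (z c c' + η * u) = c')
    (Q : ProbabilityMeasure SeriesPath) :
    ¬ GrangerCauses (boxLaw (fun c c' => (x c, y c, z c c')) δ η hq Q) := by
  rintro ⟨t, ht⟩
  apply ht
  have hfst : pastX t ≤ (inferInstance : MeasurableSpace SeriesPath) :=
    iSup₂_le fun s _ => (measurable_fst.comp (measurable_pi_apply s)).comap_le
  let V : SeriesPath → K := fun w => dec (w t).2.2
  let E : SeriesPath → ℝ := fun w => (w (t + 1)).2.1 - y (V w)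
  have hV : Measurable[pastYZ t] V := by
    have h : Measurable[pastYZ t] fun w : SeriesPath => (w t).2 := by
      rw [measurable_iff_comap_le]
      exact le_iSup₂_of_le (f := fun s (_ : s ∈ Set.Iic t) =>
        MeasurableSpace.comap (fun w : SeriesPath => (w s).2) inferInstance) t
        (Set.mem_Iic.2 le_rfl) le_rfl
    exact (hdec.comp measurable_snd).comp h
  have hE : Measurable E :=
    (by fun_prop : Measurable fun w : SeriesPath => (w (t + 1)).2.1).sub
      ((measurable_of_countable y).comp (hV.mono (pastYZ_le t) le_rfl))
  have hbox := measurable_boxSeries (fun c c' => (x c, y c, z c c')) δ η hq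
  have hsigma : sigmaY (t + 1) =
      MeasurableSpace.comap (fun w => (fun (c : K) e => y c + e) (V w) (E w)) inferInstance := by
    simp only [sigmaY, E, add_sub_cancel]
  rw [hsigma]
  refine condIndep_of_indep_noise (pastYZ_le t) hfst hV hE (g := fun c e => y c + e) ?_
    fun c => by fun_prop
  refine indep_of_indep_of_le_left (m₁ := MeasurableSpace.comap
    (fun (w : SeriesPath) (s : Set.Iio (t + 1)) => w s) inferInstance) ?_
    (sup_le (pastSigma_le_comap measurable_snd t) (pastSigma_le_comap measurable_fst t))
  rw [← IndepFun_iff_Indep, coe_boxLaw]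
  have hr : Measurable fun (w : SeriesPath) (s : Set.Iio (t + 1)) => w s := by fun_prop
  have h1 : IndepFun (fun a (s : Set.Iio (t + 1)) =>
      boxSeries q (fun c c' => (x c, y c, z c c')) δ η a s)
      (E ∘ boxSeries q (fun c c' => (x c, y c, z c c')) δ η)
      ((Q : Measure SeriesPath).prod noiseLaw) := by
    refine ((indepFun_boxSeries (fun c c' => (x c, y c, z c c')) δ η hq Q
      (t + 1)).comp measurable_id
      (by fun_prop : Measurable fun o : Obs => δ * o.2.1)).congr Filter.EventuallyEq.rfl ?_
    -- Almost surely the decoded cell is the true one, so `E` is the scaled noise `δ * u` at time `t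
    -- + 1`.
    filter_upwards [ae_noise_mem_Ico Q t] with a ha
    have hd : dec (boxSeries q (fun c c' => (x c, y c, z c c')) δ η a t).2.2 = q (a.1 (t + 1)) :=
      hz _ _ _ ha
    simp [E, V, hd]
    simp [boxSeries, boxMap]
  rw [indepFun_iff_measure_inter_preimage_eq_mul] at h1 ⊢
  intro A B hA hB
  rw [Measure.map_apply hbox ((hr hA).inter (hE hB)), Measure.map_apply hbox (hr hA),
    Measure.map_apply hbox (hE hB)]
  exact h1 A B hA hB

theorem boxLaw_mem_nullLaws (hq : Measurable q) (hdec : Measurable dec)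
    (hz : ∀ c c', ∀ u ∈ Set.Ico (0 : ℝ) 1, dec (z c c' + η * u) = c')
    (hδ : δ ≠ 0) (hη : η ≠ 0) {Q : ProbabilityMeasure SeriesPath} (hQ : IsStationaryLaw Q) :
    boxLaw (fun c c' => (x c, y c, z c c')) δ η hq Q ∈ nullLaws :=
  ⟨⟨isStationaryLaw_boxLaw _ δ η hq hQ, isContinuousLaw_boxLaw _ δ η hq hδ hη Q,
    isUnconfoundedStructural_boxLaw hq hdec hz Q⟩, not_grangerCauses_boxLaw hq hdec hz Q⟩

end BoxSeries

/-! ### Random subintervals and random codes -/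

/-- Points of the `M + 1` equal subintervals of the unit interval. -/
noncomputable def gridMap (M : ℕ) (a : Fin (M + 1) × Obs) : Obs :=
  (a.2.1, a.2.2.1, ((a.1 : ℝ) + a.2.2.2) / (M + 1))

/-- The uniform distribution on a finite set with `M + 1` elements. -/
noncomputable abbrev uniformFin (M : ℕ) : Measure (Fin (M + 1)) := uniformOn Set.univ

instance (M : ℕ) : IsProbabilityMeasure (uniformFin M) :=
  isProbabilityMeasure_uniformOn Set.finite_univ Set.univ_nonempty

theorem uniformFin_singleton (M : ℕ) (j : Fin (M + 1)) :
    uniformFin M {j} = ((M : ENNReal) + 1)⁻¹ := by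
  rw [uniformFin, uniformOn_univ]
  simp

@[fun_prop]
theorem measurable_gridMap (M : ℕ) : Measurable (gridMap M) := by
  refine measurable_from_prod_countable_right fun j => ?_
  unfold gridMap
  fun_prop

theorem uniformFin_prod_unitLaw_map (M : ℕ) :
    ((uniformFin M).prod unitLaw).map (fun a : Fin (M + 1) × ℝ => ((a.1 : ℝ) + a.2) / (M + 1)) =
      unitLaw := by
  have hm : Measurable fun a : Fin (M + 1) × ℝ => ((a.1 : ℝ) + a.2) / (M + 1) :=
    measurable_from_prod_countable_right fun j => by fun_prop
  have hM : (0 : ℝ) < M + 1 := by positivity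
  refine Measure.ext fun A hA => ?_
  rw [Measure.map_apply hm hA, Measure.prod_apply (hm hA), lintegral_fintype]
  -- The `j`-th subinterval, half-open so that the subintervals partition `[0, 1)`; the endpoint 1
  -- is null.
  let S : Fin (M + 1) → Set ℝ := fun j => {r | ⌊((M : ℝ) + 1) * r⌋ = (j : ℤ)}
  have hS (j : Fin (M + 1)) : MeasurableSet (S j) :=
    (Int.measurable_floor.comp (measurable_const_mul _)) (measurableSet_singleton _)
  have hcell (j : Fin (M + 1)) :
      unitLaw (Prod.mk j ⁻¹' ((fun a : Fin (M + 1) × ℝ => ((a.1 : ℝ) + a.2) / (M + 1)) ⁻¹' A)) =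
        ((M : ENNReal) + 1) * volume (A ∩ S j) := by
    have h1 : Prod.mk j ⁻¹' ((fun a : Fin (M + 1) × ℝ => ((a.1 : ℝ) + a.2) / (M + 1)) ⁻¹' A) ∩
        Set.Ico 0 1 = (fun u => (j : ℝ) + u) ⁻¹' ((fun r => ((M : ℝ) + 1)⁻¹ * r) ⁻¹' (A ∩ S j)) := by
      ext u
      have h2 : ((M : ℝ) + 1) * (((M : ℝ) + 1)⁻¹ * (j + u)) = (j + u : ℝ) := by
        field_simp
      simp only [Set.mem_inter_iff, Set.mem_preimage, S, Set.mem_ofPred_eq, h2, Set.mem_Ico,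
        Int.floor_eq_iff, div_eq_inv_mul, Int.cast_natCast, le_add_iff_nonneg_right,
        add_lt_add_iff_left]
    rw [unitLaw, ← restrict_Ico_eq_restrict_Icc, Measure.restrict_apply' measurableSet_Ico, h1,
      measure_preimage_add, Real.volume_preimage_mul_left (inv_ne_zero hM.ne'), inv_inv,
      abs_of_pos hM, ENNReal.ofReal_add (by positivity) zero_le_one]
    simp
  have hunion : A ∩ Set.Ico 0 1 = ⋃ j, A ∩ S j := by
    rw [← Set.inter_iUnion]
    congr 1
    ext r
    simp only [S, Set.mem_iUnion, Set.mem_ofPred_eq, Set.mem_Ico]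
    constructor
    · rintro ⟨h0, h1⟩
      have h2 : 0 ≤ ⌊((M : ℝ) + 1) * r⌋ := Int.floor_nonneg.2 (by positivity)
      have h3 : ⌊((M : ℝ) + 1) * r⌋ < (M : ℤ) + 1 := by
        rw [Int.floor_lt]
        push_cast
        nlinarith
      exact ⟨⟨⌊((M : ℝ) + 1) * r⌋.toNat, by omega⟩, by simp [h2]⟩
    · rintro ⟨j, hj⟩
      rw [Int.floor_eq_iff] at hj
      have hj1 : (j : ℝ) + 1 ≤ M + 1 := by exact_mod_cast j.2
      have hj0 : (0 : ℝ) ≤ j := by positivity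
      push_cast at hj
      exact ⟨by nlinarith [hj.1], by nlinarith [hj.2]⟩
  simp only [hcell, uniformFin_singleton]
  rw [unitLaw, ← restrict_Ico_eq_restrict_Icc, Measure.restrict_apply' measurableSet_Ico, hunion,
    measure_iUnion _ fun j => hA.inter (hS j), tsum_fintype]
  · refine Finset.sum_congr rfl fun j _ => ?_
    rw [mul_comm, ← mul_assoc, ENNReal.inv_mul_cancel (by simp) (by simp), one_mul]
  · intro i j hij
    refine Set.disjoint_left.2 fun r hi hj => hij ?_
    have : (i : ℤ) = j := hi.2.symm.trans hj.2
    exact Fin.ext (by exact_mod_cast this)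

theorem cubeLaw_map_gridMap (M : ℕ) :
    ((uniformFin M).prod cubeLaw).map (gridMap M) = cubeLaw := by
  have hm : Measurable fun a : Fin (M + 1) × ℝ => ((a.1 : ℝ) + a.2) / (M + 1) :=
    measurable_from_prod_countable_right fun j => by fun_prop
  have h : MeasurePreserving (fun a : Fin (M + 1) × ℝ => ((a.1 : ℝ) + a.2) / (M + 1))
      ((uniformFin M).prod unitLaw) unitLaw := ⟨hm, uniformFin_prod_unitLaw_map M⟩
  have hswap {β γ : Type} [MeasurableSpace β] [MeasurableSpace γ] {ν : Measure β} {ρ : Measure γ}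
      [SFinite ν] [SFinite ρ] {f : Fin (M + 1) × β → γ}
      (hf : MeasurePreserving f ((uniformFin M).prod ν) ρ) :
      MeasurePreserving (fun a : Fin (M + 1) × ℝ × β => (a.2.1, f (a.1, a.2.2)))
        ((uniformFin M).prod (unitLaw.prod ν)) (unitLaw.prod ρ) := by
    have h1 := (measurePreserving_prodAssoc (uniformFin M) unitLaw ν).symm
    have h2 := (Measure.measurePreserving_swap (μ := uniformFin M) (ν := unitLaw)).prod
      (MeasurePreserving.id ν)
    have h3 := measurePreserving_prodAssoc unitLaw (uniformFin M) ν
    exact ((MeasurePreserving.id unitLaw).prod hf).comp (h3.comp (h2.comp h1))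
  exact (hswap (hswap h)).map_eq

theorem pi_map_gridMap (M n : ℕ) {A : Set (Fin n → Obs)} (hA : MeasurableSet A) :
    ∫⁻ v, Measure.pi (fun _ : Fin n => cubeLaw) {u | (fun i => gridMap M (v i, u i)) ∈ A}
      ∂(Measure.pi fun _ : Fin n => uniformFin M) = Measure.pi (fun _ : Fin n => cubeLaw) A := by
  have hm : Measurable fun (a : Fin n → Fin (M + 1) × Obs) i => gridMap M (a i) :=
    measurable_pi_lambda _ fun i => (measurable_gridMap M).comp (measurable_pi_apply i)
  have h1 := (measurePreserving_arrowProdEquivProdArrow (Fin (M + 1)) Obs (Fin n)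
    (fun _ => uniformFin M) fun _ => cubeLaw).symm
  have h2 := Measure.pi_map_pi (μ := fun _ : Fin n => (uniformFin M).prod cubeLaw)
    (f := fun _ => gridMap M) fun _ => (measurable_gridMap M).aemeasurable
  simp only [cubeLaw_map_gridMap] at h2
  conv_rhs => rw [← h2, Measure.map_apply hm hA, ← h1.map_eq,
    Measure.map_apply h1.measurable (hm hA), Measure.prod_apply (h1.measurable (hm hA))]
  rfl

theorem infinitePi_uniformFin_eq_le {L : Type} (M : ℕ) {a b : L} (hab : a ≠ b) :
    Measure.infinitePi (fun _ : L => uniformFin M) {e | e a = e b} ≤ ((M : ENNReal) + 1)⁻¹ := by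
  classical
  have hcover : {e : L → Fin (M + 1) | e a = e b} =
      ⋃ j : Fin (M + 1), Set.pi (({a, b} : Finset L) : Set L) fun _ => {j} := by
    ext e
    simp [eq_comm]
  rw [hcover]
  refine (measure_iUnion_fintype_le _ _).trans ?_
  have h (j : Fin (M + 1)) : Measure.infinitePi (fun _ : L => uniformFin M)
      (Set.pi (({a, b} : Finset L) : Set L) fun _ => {j}) =
        ((M : ENNReal) + 1)⁻¹ * ((M : ENNReal) + 1)⁻¹ := by
    rw [Measure.infinitePi_pi _ fun _ _ => measurableSet_singleton j, Finset.prod_pair hab,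
      uniformFin_singleton]
  simp only [h, Finset.sum_const, Finset.card_univ, Fintype.card_fin, nsmul_eq_mul]
  rw [← mul_assoc, Nat.cast_add, Nat.cast_one, ENNReal.mul_inv_cancel (by simp) (by simp), one_mul]

/-- A birthday estimate: union bound over pairs, each colliding with probability `1 / (M + 1)`. -/
theorem infinitePi_uniformFin_not_injective_le (L : Type) [Fintype L] (M : ℕ) :
    Measure.infinitePi (fun _ : L => uniformFin M) {e | ¬ Function.Injective e} ≤
      (Fintype.card (L × L) : ENNReal) * ((M : ENNReal) + 1)⁻¹ := by
  classical
  have hcover : {e : L → Fin (M + 1) | ¬ Function.Injective e} ⊆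
      ⋃ a : L × L, if a.1 = a.2 then ∅ else {e | e a.1 = e a.2} := by
    intro e he
    simp only [Set.mem_ofPred_eq, Function.Injective, not_forall] at he
    obtain ⟨a, b, h, hab⟩ := he
    refine Set.mem_iUnion.2 ⟨(a, b), ?_⟩
    simp [hab, h]
  refine (measure_mono hcover).trans ((measure_iUnion_fintype_le _ _).trans ?_)
  refine (Finset.sum_le_card_nsmul _ _ (((M : ENNReal) + 1)⁻¹) fun a _ => ?_).trans ?_
  · split_ifs with h
    · simp
    · exact infinitePi_uniformFin_eq_le M h
  · simp

/-! ### Null laws from codes, and averaging over the code -/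

/-- The corner `δ k` of the box of side `δ` with index `k`. -/
def gridCorner (δ : ℝ) (k : ℤ × ℤ × ℤ) : Obs := (δ * k.1, δ * k.2.1, δ * k.2.2)

/-- The third coordinate of the box in which the pair of consecutive cells `c`, `c'` is recorded by
the subinterval with index `e (c, c')`. -/
noncomputable def embedCoord {K : Type} (κ : K → ℤ × ℤ × ℤ) (δ : ℝ) {M : ℕ}
    (e : K × K → Fin (M + 1)) (c c' : K) : ℝ := δ * ((κ c).2.2 + (e (c, c') : ℝ) / (M + 1))

theorem boxMap_embedCoord {K : Type} (κ : K → ℤ × ℤ × ℤ) (δ : ℝ) {M : ℕ}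
    (e : K × K → Fin (M + 1)) (c c' : K) (u : Obs) :
    boxMap δ (δ / (M + 1)) (δ * (κ c).1, δ * (κ c).2.1, embedCoord κ δ e c c') u =
      boxMap δ δ (gridCorner δ (κ c)) (gridMap M (e (c, c'), u)) := by
  simp only [boxMap, gridMap, gridCorner, embedCoord, Prod.mk.injEq, true_and]
  ring

/-- The probability that the point with independent uniform coordinates in the boxes with
indices `k i` lies in `R`. -/
noncomputable def boxProb (δ : ℝ) {n : ℕ} (R : Set (Fin n → Obs)) (k : Fin n → ℤ × ℤ × ℤ) :
    ENNReal :=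
  Measure.pi (fun _ : Fin n => cubeLaw) {u | (fun i => boxMap δ δ (gridCorner δ (k i)) (u i)) ∈ R}

section Embedding

variable {K : Type} [Fintype K] [MeasurableSpace K] [MeasurableSingletonClass K]
  {q : Obs → K} {κ : K → ℤ × ℤ × ℤ} {δ : ℝ}

/-- The law of the series whose third component records pairs of consecutive cells through `e`. -/
noncomputable def embedLaw (hq : Measurable q) (κ : K → ℤ × ℤ × ℤ) (δ : ℝ) {M : ℕ}
    (e : K × K → Fin (M + 1)) (Q : ProbabilityMeasure SeriesPath) :
    ProbabilityMeasure SeriesPath :=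
  boxLaw (fun c c' => (δ * (κ c).1, δ * (κ c).2.1, embedCoord κ δ e c c')) δ (δ / (M + 1)) hq Q

theorem embedLaw_mem_nullLaws (hq : Measurable q) (κ : K → ℤ × ℤ × ℤ) (hδ : 0 < δ) {M : ℕ}
    {e : K × K → Fin (M + 1)} (he : Function.Injective e) {Q : ProbabilityMeasure SeriesPath}
    (hQ : IsStationaryLaw Q) : embedLaw hq κ δ e Q ∈ nullLaws := by
  have : Nonempty K := ⟨q 0⟩
  have hM : (0 : ℝ) < M + 1 := by positivity
  -- The index of the subinterval in the global grid of mesh `δ / (M + 1)`. Its residue modulo `M +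
  -- 1` is the code, so injectivity of `e` alone suffices for decoding.
  let s : K × K → ℤ := fun a => (κ a.1).2.2 * (M + 1) + (e a : ℕ)
  have hs : Function.Injective s := by
    intro a b hab
    apply he
    have h (a : K × K) : s a % ((M : ℤ) + 1) = (e a : ℕ) := by
      simp only [s]
      rw [Int.mul_add_emod_self_right]
      exact Int.emod_eq_of_lt (by positivity) (by exact_mod_cast (e a).2)
    have := (h a).symm.trans ((congrArg (· % ((M : ℤ) + 1)) hab).trans (h b))
    exact Fin.ext (by exact_mod_cast this)
  let dec : ℝ → K := fun r => (Function.invFun s ⌊r / (δ / (M + 1))⌋).2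
  have hdec : Measurable dec :=
    (measurable_of_countable fun m : ℤ => (Function.invFun s m).2).comp
      (Int.measurable_floor.comp (measurable_id.div_const _))
  refine boxLaw_mem_nullLaws (x := fun c => δ * (κ c).1) (y := fun c => δ * (κ c).2.1)
    (z := embedCoord κ δ e) (dec := dec) hq hdec (fun c c' u hu => ?_) hδ.ne'
    (div_pos hδ hM).ne' hQ
  have h1 : (embedCoord κ δ e c c' + δ / (M + 1) * u) / (δ / (M + 1)) = (s (c, c') : ℤ) + u := by
    simp only [embedCoord, s]
    push_cast
    field_simp
  have h2 : ⌊(embedCoord κ δ e c c' + δ / (M + 1) * u) / (δ / (M + 1))⌋ = s (c, c') := by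
    rw [h1, Int.floor_intCast_add, Int.floor_eq_zero_iff.2 hu, add_zero]
  simp only [dec, h2, Function.leftInverse_invFun hs (c, c')]

theorem lintegral_embedLaw (hq : Measurable q) (κ : K → ℤ × ℤ × ℤ) (δ : ℝ) (M : ℕ) {n : ℕ}
    {R : Set (Fin n → Obs)} (hR : MeasurableSet R) (Q : ProbabilityMeasure SeriesPath) :
    ∫⁻ w, {w | Function.Injective fun i => q (obsWindow n w i)}.indicator
        (fun w => boxProb δ R fun i => κ (q (obsWindow n w i))) w ∂Q ≤
      ∫⁻ e, (embedLaw hq κ δ e Q : Measure SeriesPath) (obsWindow n ⁻¹' R)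
        ∂(Measure.infinitePi fun _ : K × K => uniformFin M) := by
  let ℓ : SeriesPath → Fin n → K × K := fun w i => (q (obsWindow n w i), q (w ((i : ℤ) + 1 + 1)))
  have hℓ : Measurable ℓ := by
    unfold ℓ obsWindow
    fun_prop
  let H : (K × K → Fin (M + 1)) → (Fin n → K × K) → ENNReal := fun e l =>
    Measure.pi (fun _ : Fin n => cubeLaw)
      {u | (fun i => boxMap δ δ (gridCorner δ (κ (l i).1)) (gridMap M (e (l i), u i))) ∈ R}
  have hH (e : K × K → Fin (M + 1)) :
      (embedLaw hq κ δ e Q : Measure SeriesPath) (obsWindow n ⁻¹' R) = ∫⁻ w, H e (ℓ w) ∂Q := by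
    rw [embedLaw, boxLaw_obsWindow_preimage _ _ _ hq Q hR]
    simp only [boxMap_embedCoord]
    rfl
  simp only [hH]
  rw [lintegral_lintegral_swap]
  · refine lintegral_mono fun w => ?_
    by_cases hw : Function.Injective fun i => q (obsWindow n w i)
    swap
    · rw [Set.indicator_of_notMem (by exact hw)]
      exact zero_le
    rw [Set.indicator_of_mem (by exact hw)]
    -- Distinct present cells already make the pairs distinct, whatever the cell at time `n + 1`, so
    -- the codes along the window are independent and uniform.
    have hinj : Function.Injective (ℓ w) := fun i j hij => hw (congrArg Prod.fst hij)
    have hmap := Measure.map_infinitePi_infinitePi_of_inj (P := fun _ : K × K => uniformFin M) hinj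
    rw [Measure.infinitePi_eq_pi (μ := fun _ : Fin n => uniformFin M)] at hmap
    have hA : MeasurableSet {v : Fin n → Obs |
        (fun i => boxMap δ δ (gridCorner δ (κ (ℓ w i).1)) (v i)) ∈ R} :=
      hR.preimage <| measurable_pi_lambda _ fun i =>
        (measurable_boxMap δ δ).comp (measurable_const.prodMk (measurable_pi_apply i))
    refine (pi_map_gridMap M n hA).symm.le.trans ?_
    rw [← hmap, lintegral_map (measurable_of_countable _) (by fun_prop)]
    exact le_rfl
  · refine Measurable.aemeasurable (measurable_from_prod_countable_right fun e => ?_)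
    exact (measurable_of_countable (H e)).comp hℓ

theorem lintegral_boxProb_le (hq : Measurable q) (κ : K → ℤ × ℤ × ℤ) (hδ : 0 < δ) {n : ℕ}
    {R : Set (Fin n → Obs)} (hR : MeasurableSet R) {a : ENNReal}
    (ha : ∀ P ∈ nullLaws, (P : Measure SeriesPath) (obsWindow n ⁻¹' R) ≤ a)
    {Q : ProbabilityMeasure SeriesPath} (hQ : IsStationaryLaw Q) :
    ∫⁻ w, {w | Function.Injective fun i => q (obsWindow n w i)}.indicator
        (fun w => boxProb δ R fun i => κ (q (obsWindow n w i))) w ∂Q ≤ a := by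
  have hbound (M : ℕ) : ∫⁻ w, {w | Function.Injective fun i => q (obsWindow n w i)}.indicator
        (fun w => boxProb δ R fun i => κ (q (obsWindow n w i))) w ∂Q ≤
      a + (Fintype.card ((K × K) × (K × K)) : ENNReal) * ((M : ENNReal) + 1)⁻¹ := by
    refine (lintegral_embedLaw hq κ δ M hR Q).trans ?_
    -- A non-injective code need not give a null law; its rejection probability is bounded by 1.
    have hle (e : K × K → Fin (M + 1)) :
        (embedLaw hq κ δ e Q : Measure SeriesPath) (obsWindow n ⁻¹' R) ≤
          a + {e : K × K → Fin (M + 1) | ¬ Function.Injective e}.indicator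
            (1 : (K × K → Fin (M + 1)) → ENNReal) e := by
      by_cases he : Function.Injective e
      · exact (ha _ (embedLaw_mem_nullLaws hq κ hδ he hQ)).trans le_self_add
      · rw [Set.indicator_of_mem (by exact he)]
        exact prob_le_one.trans le_add_self
    refine (lintegral_mono hle).trans ?_
    rw [lintegral_add_left measurable_const, lintegral_const, measure_univ, mul_one,
      lintegral_indicator_one (Set.toFinite _).measurableSet]
    gcongr
    exact infinitePi_uniformFin_not_injective_le (K × K) M
  have hlim : Filter.Tendsto (fun M : ℕ => a + (Fintype.card ((K × K) × (K × K)) : ENNReal) *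
      ((M : ENNReal) + 1)⁻¹) Filter.atTop (nhds (a + (Fintype.card ((K × K) × (K × K)) : ENNReal) *
        0)) := by
    refine tendsto_const_nhds.add (ENNReal.Tendsto.const_mul ?_ (Or.inr (ENNReal.natCast_ne_top _)))
    have := (Filter.tendsto_add_atTop_iff_nat 1).2 ENNReal.tendsto_inv_nat_nhds_zero
    simpa using this
  rw [mul_zero, add_zero] at hlim
  exact ge_of_tendsto' hlim hbound

end Embedding

/-! ### Truncated grids that separate points -/

/-- The integer part of `(k + 1) r`, truncated to the interval `[-(k + 1)², (k + 1)²]`. -/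
noncomputable def clampFloor (k : ℕ) (r : ℝ) :
    Set.Icc (-((k : ℤ) + 1) ^ 2) (((k : ℤ) + 1) ^ 2) :=
  Set.projIcc _ _ (by nlinarith [sq_nonneg ((k : ℤ) + 1)]) ⌊((k : ℝ) + 1) * r⌋

/-- The finite set of cells of the truncated grid of mesh `1 / (k + 1)`. -/
abbrev Cell (k : ℕ) : Type :=
  Set.Icc (-((k : ℤ) + 1) ^ 2) (((k : ℤ) + 1) ^ 2) ×
    Set.Icc (-((k : ℤ) + 1) ^ 2) (((k : ℤ) + 1) ^ 2) ×
      Set.Icc (-((k : ℤ) + 1) ^ 2) (((k : ℤ) + 1) ^ 2)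

/-- The cell that contains an observation. -/
noncomputable def cellOf (k : ℕ) (o : Obs) : Cell k :=
  (clampFloor k o.1, clampFloor k o.2.1, clampFloor k o.2.2)

/-- The integer coordinates of a cell. -/
def cellIndex (k : ℕ) (c : Cell k) : ℤ × ℤ × ℤ := (c.1, c.2.1, c.2.2)

theorem measurable_clampFloor (k : ℕ) : Measurable (clampFloor k) :=
  (measurable_of_countable (Set.projIcc _ _ _)).comp
    (Int.measurable_floor.comp (measurable_const_mul _))

theorem measurable_cellOf (k : ℕ) : Measurable (cellOf k) :=
  ((measurable_clampFloor k).comp measurable_fst).prodMk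
    (((measurable_clampFloor k).comp (measurable_fst.comp measurable_snd)).prodMk
      ((measurable_clampFloor k).comp (measurable_snd.comp measurable_snd)))

theorem eventually_clampFloor_eq (r : ℝ) :
    ∀ᶠ k in atTop, (clampFloor k r : ℤ) = ⌊((k : ℝ) + 1) * r⌋ := by
  -- If `|r| ≤ k`, then `|(k + 1) r| ≤ k (k + 1)`, within the truncation bound `(k + 1)²`.
  filter_upwards [eventually_ge_atTop ⌈|r|⌉₊] with k hk
  have hr : |r| ≤ k := Nat.ceil_le.1 hk
  have hr' := abs_le.1 hr
  have hk0 : (0 : ℝ) ≤ k := by positivity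
  rw [clampFloor, Set.projIcc_of_mem]
  constructor
  · rw [Int.le_floor]
    push_cast
    nlinarith
  · rw [← Int.lt_add_one_iff, Int.floor_lt]
    push_cast
    nlinarith

theorem eventually_clampFloor_ne {r r' : ℝ} (h : r ≠ r') :
    ∀ᶠ k in atTop, clampFloor k r ≠ clampFloor k r' := by
  have hpos : 0 < |r - r'| := abs_pos.2 (sub_ne_zero.2 h)
  filter_upwards [eventually_clampFloor_eq r, eventually_clampFloor_eq r',
    eventually_ge_atTop ⌈|r - r'|⁻¹⌉₊] with k h1 h2 hk heq
  have hk' : |r - r'|⁻¹ ≤ k := Nat.ceil_le.1 hk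
  have hlt : |((k : ℝ) + 1) * r - ((k : ℝ) + 1) * r'| < 1 :=
    Int.abs_sub_lt_one_of_floor_eq_floor (by rw [← h1, ← h2, heq])
  rw [← mul_sub, abs_mul, abs_of_nonneg (by positivity)] at hlt
  have : 1 ≤ (k : ℝ) * |r - r'| := by
    rwa [← div_le_iff₀ hpos, one_div]
  nlinarith

theorem eventually_cellOf_ne {a b : Obs} (h : a ≠ b) : ∀ᶠ k in atTop, cellOf k a ≠ cellOf k b := by
  simp only [cellOf, ne_eq, Prod.mk.injEq, not_and_or]
  by_cases h1 : a.1 = b.1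
  · by_cases h2 : a.2.1 = b.2.1
    · have h3 : a.2.2 ≠ b.2.2 := fun h3 => h (Prod.ext h1 (Prod.ext h2 h3))
      filter_upwards [eventually_clampFloor_ne h3] with k hk using Or.inr (Or.inr hk)
    · filter_upwards [eventually_clampFloor_ne h2] with k hk using Or.inr (Or.inl hk)
  · filter_upwards [eventually_clampFloor_ne h1] with k hk using Or.inl hk

theorem eventually_injective_cellOf {n : ℕ} {x : Fin n → Obs} (hx : Function.Injective x) :
    ∀ᶠ k in atTop, Function.Injective fun i => cellOf k (x i) := by
  have h : ∀ᶠ k in atTop, ∀ i j, i ≠ j → cellOf k (x i) ≠ cellOf k (x j) := by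
    simp only [eventually_all]
    exact fun i j hij => eventually_cellOf_ne (hx.ne hij)
  filter_upwards [h] with k hk i j hij
  by_contra hne
  exact hk i j hne hij

/-- Each diagonal `x i = x j` is a proper linear subspace, hence null. -/
theorem ae_injective (n : ℕ) : ∀ᵐ x : Fin n → Obs, Function.Injective x := by
  have h : ∀ i j : Fin n, i ≠ j → ∀ᵐ x : Fin n → Obs, x i ≠ x j := by
    intro i j hij
    let S : Submodule ℝ (Fin n → Obs) := LinearMap.ker
      (LinearMap.proj (R := ℝ) (φ := fun _ : Fin n => Obs) i - LinearMap.proj j)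
    have hS : S ≠ ⊤ := by
      intro htop
      have h1 : Pi.single i (1 : Obs) ∈ S := htop ▸ Submodule.mem_top
      simp [S, hij.symm] at h1
    refine measure_mono_null (fun x hx => ?_) (Measure.addHaar_submodule volume S hS)
    have hx' : x i = x j := not_not.1 hx
    simp [S, hx']
  have h' : ∀ᵐ x : Fin n → Obs, ∀ i j, i ≠ j → x i ≠ x j := by
    simp only [ae_all_iff]
    exact h
  filter_upwards [h'] with x hx i j hij
  by_contra hne
  exact hx i j hne hij

/-! ### Box proportions and Lebesgue density -/

theorem pi_cubeLaw_eq_restrict (n : ℕ) :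
    Measure.pi (fun _ : Fin n => cubeLaw) =
      volume.restrict (Metric.closedBall (fun _ => (1 / 2, 1 / 2, 1 / 2)) (1 / 2)) := by
  have hIcc : Set.Icc (0 : ℝ) 1 = Metric.closedBall (1 / 2) (1 / 2) := by
    rw [Real.closedBall_eq_Icc]
    norm_num
  rw [cubeLaw, Measure.prod_restrict, Measure.prod_restrict, ← Measure.restrict_pi_pi, hIcc,
    closedBall_prod_same, closedBall_prod_same, closedBall_pi _ (by norm_num)]
  rfl

/-- In the sup norm a product of boxes of side `δ` is a closed ball of radius `δ / 2`, which puts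
`boxProb` in the form of the density theorem. -/
theorem boxProb_eq_div {δ : ℝ} (hδ : 0 < δ) {n : ℕ} (R : Set (Fin n → Obs))
    (k : Fin n → ℤ × ℤ × ℤ) :
    boxProb δ R k =
      volume (R ∩ Metric.closedBall
        (fun i => boxMap δ δ (gridCorner δ (k i)) (1 / 2, 1 / 2, 1 / 2)) (δ / 2)) /
      volume (Metric.closedBall
        (fun i => boxMap δ δ (gridCorner δ (k i)) (1 / 2, 1 / 2, 1 / 2)) (δ / 2)) := by
  let h : Fin n → Obs := fun _ => (1 / 2, 1 / 2, 1 / 2)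
  let c : Fin n → Obs := fun i => ((k i).1, (k i).2.1, (k i).2.2)
  let f : (Fin n → Obs) → Fin n → Obs := fun v => δ • (c + v)
  have hf (v : Fin n → Obs) : (fun i => boxMap δ δ (gridCorner δ (k i)) (v i)) = f v := by
    funext i
    ext <;> simp [f, c, boxMap, gridCorner]
  have hball : f ⁻¹' Metric.closedBall (f h) (δ / 2) = Metric.closedBall h (1 / 2) := by
    ext v
    simp only [f, Set.mem_preimage, Metric.mem_closedBall, dist_smul₀, dist_add_left,
      Real.norm_eq_abs, abs_of_pos hδ, div_eq_mul_one_div δ 2]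
    exact mul_le_mul_iff_right₀ hδ
  obtain ⟨C, hC⟩ : ∃ C : ENNReal, ∀ S, volume (f ⁻¹' S) = C * volume S := by
    refine ⟨ENNReal.ofReal |(δ ^ Module.finrank ℝ (Fin n → Obs))⁻¹|, fun S => ?_⟩
    rw [show f ⁻¹' S = (fun v => c + v) ⁻¹' ((fun v => δ • v) ⁻¹' S) from rfl,
      measure_preimage_add, Measure.addHaar_preimage_smul _ hδ.ne']
  have hone : C * volume (Metric.closedBall (f h) (δ / 2)) = 1 := by
    rw [← hC, hball, ← Measure.restrict_apply_univ, ← pi_cubeLaw_eq_restrict, measure_univ]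
  have hR : boxProb δ R k = C * volume (R ∩ Metric.closedBall (f h) (δ / 2)) := by
    rw [← hC, Set.preimage_inter, hball, boxProb, pi_cubeLaw_eq_restrict,
      Measure.restrict_apply' Metric.isClosed_closedBall.measurableSet]
    simp only [hf]
    rfl
  rw [hf h, hR, ENNReal.eq_inv_of_mul_eq_one_left hone, mul_comm]
  rfl

theorem eventually_abs_sub_clampFloor_le (r : ℝ) :
    ∀ᶠ k : ℕ in atTop,
      |r - (1 / ((k : ℝ) + 1) * (clampFloor k r : ℤ) + 1 / ((k : ℝ) + 1) * (1 / 2))| ≤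
        1 / ((k : ℝ) + 1) / 2 := by
  filter_upwards [eventually_clampFloor_eq r] with k hk
  have hk0 : (0 : ℝ) < k + 1 := by positivity
  rw [hk]
  have h1 := Int.floor_le (((k : ℝ) + 1) * r)
  have h2 := Int.lt_floor_add_one (((k : ℝ) + 1) * r)
  have h3 : r - (1 / ((k : ℝ) + 1) * ⌊((k : ℝ) + 1) * r⌋ + 1 / ((k : ℝ) + 1) * (1 / 2)) =
      1 / ((k : ℝ) + 1) * (((k : ℝ) + 1) * r - ⌊((k : ℝ) + 1) * r⌋ - 1 / 2) := by
    field_simp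
    ring
  rw [h3, abs_mul, abs_of_pos (by positivity), div_eq_mul_one_div _ (2 : ℝ)]
  refine mul_le_mul_of_nonneg_left ?_ (by positivity)
  rw [abs_le]
  constructor <;> linarith

theorem ae_tendsto_boxProb {n : ℕ} {R : Set (Fin n → Obs)} (hR : MeasurableSet R) :
    ∀ᵐ x : Fin n → Obs, x ∈ R → Tendsto (fun k : ℕ =>
      boxProb (1 / ((k : ℝ) + 1)) R fun i => cellIndex k (cellOf k (x i))) atTop (𝓝 1) := by
  have h := IsUnifLocDoublingMeasure.ae_tendsto_measure_inter_div
    (volume : Measure (Fin n → Obs)) R 1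
  rw [ae_restrict_iff' hR] at h
  filter_upwards [h] with x hx hxR
  have hpos (k : ℕ) : (0 : ℝ) < 1 / ((k : ℝ) + 1) := by positivity
  simp only [boxProb_eq_div (hpos _)]
  -- The balls are centred at cell midpoints, not at `x`; the density theorem used here only asks
  -- that they eventually contain `x`.
  refine hx hxR _ (fun k : ℕ => 1 / ((k : ℝ) + 1) / 2) ?_ ?_
  · refine tendsto_nhdsWithin_iff.2 ⟨?_, Eventually.of_forall fun k => half_pos (hpos k)⟩
    simpa using tendsto_one_div_add_atTop_nhds_zero_nat.div_const (2 : ℝ)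
  · have h1 (i : Fin n) := (eventually_abs_sub_clampFloor_le (x i).1).and
      ((eventually_abs_sub_clampFloor_le (x i).2.1).and
        (eventually_abs_sub_clampFloor_le (x i).2.2))
    filter_upwards [eventually_all.2 h1] with k hk
    rw [one_mul, Metric.mem_closedBall, dist_pi_le_iff (half_pos (hpos k)).le]
    intro i
    obtain ⟨ha, hb, hc⟩ := hk i
    simp only [Prod.dist_eq, Real.dist_eq, max_le_iff]
    exact ⟨ha, hb, hc⟩

/-! ### Passage to the limit -/

theorem theorem4 (n : ℕ) (α : ℝ) (hα : α ∈ Set.Ioo (0 : ℝ) 1)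
    (ψ : (Fin n → Obs) → Fin 2) (hψ : Measurable ψ)
    (hlevel : (⨆ P ∈ nullLaws, rejectionProb ψ P) ≤ ENNReal.ofReal α) :
    ∀ Q ∈ alternativeLaws, rejectionProb ψ Q ≤ ENNReal.ofReal α := by
  rintro Q ⟨⟨hstat, hcont, -⟩, -⟩
  let R : Set (Fin n → Obs) := ψ ⁻¹' {1}
  have hR : MeasurableSet R := hψ (measurableSet_singleton 1)
  have hnull : ∀ P ∈ nullLaws, (P : Measure SeriesPath) (obsWindow n ⁻¹' R) ≤ ENNReal.ofReal α :=
    fun P hP => (le_iSup₂ (f := fun P (_ : P ∈ nullLaws) => rejectionProb ψ P) P hP).trans hlevel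
  let φ : ℕ → SeriesPath → ENNReal := fun k =>
    {w | Function.Injective fun i => cellOf k (obsWindow n w i)}.indicator
      fun w => boxProb (1 / ((k : ℝ) + 1)) R fun i => cellIndex k (cellOf k (obsWindow n w i))
  have hφ (k : ℕ) : ∫⁻ w, φ k w ∂Q ≤ ENNReal.ofReal α :=
    lintegral_boxProb_le (measurable_cellOf k) (cellIndex k) (by positivity) hR hnull hstat
  have hφm (k : ℕ) : Measurable (φ k) := by
    classical
    have h : Measurable fun w i => cellOf k (obsWindow n w i) :=
      measurable_pi_lambda _ fun i => (measurable_cellOf k).comp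
        ((measurable_pi_apply i).comp (measurable_obsWindow n))
    exact (measurable_of_countable fun c : Fin n → Cell k =>
      {c : Fin n → Cell k | Function.Injective c}.indicator
        (fun c => boxProb (1 / ((k : ℝ) + 1)) R fun i => cellIndex k (c i)) c).comp h
  have hlim : ∀ᵐ w ∂(Q : Measure SeriesPath),
      (obsWindow n ⁻¹' R).indicator 1 w ≤ liminf (fun k => φ k w) atTop := by
    -- Absolute continuity of the window's law transfers the Lebesgue-almost-everywhere facts to Q.
    have h := (hcont n).ae_le ((ae_injective n).and (ae_tendsto_boxProb hR))
    filter_upwards [ae_of_ae_map (measurable_obsWindow n).aemeasurable h] with w hw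
    by_cases hwR : obsWindow n w ∈ R
    · rw [Set.indicator_of_mem (by exact hwR)]
      refine ((hw.2 hwR).congr' ?_).liminf_eq.ge
      filter_upwards [eventually_injective_cellOf hw.1] with k hk
      simp only [φ]
      rw [Set.indicator_of_mem (by exact hk)]
    · rw [Set.indicator_of_notMem (by exact hwR)]
      exact zero_le
  calc rejectionProb ψ Q = ∫⁻ w, (obsWindow n ⁻¹' R).indicator 1 w ∂Q :=
        (lintegral_indicator_one (measurable_obsWindow n hR)).symm
    _ ≤ ∫⁻ w, liminf (fun k => φ k w) atTop ∂Q := lintegral_mono_ae hlim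
    _ ≤ liminf (fun k => ∫⁻ w, φ k w ∂Q) atTop := lintegral_liminf_le hφm
    _ ≤ ENNReal.ofReal α := by
        refine (liminf_le_liminf (Eventually.of_forall hφ)).trans ?_
        simp
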